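/- An additively idempotent semiring (ai-semiring) is a nonempty set with two binary operations $+$ and $\cdot$ such that $+$ is commutative, associative and idempotent, $\cdot$ is associative, and $\cdot$ distributes over $+$ on both sides. A variety is a class of ai-semirings closed under homomorphic images, subalgebras and direct products (isomorphic copies included); $\mathsf{V}(K)$ is the smallest variety containing $K$. A flat semiring is an ai-semiring whose multiplication has a zero element $0$ and in which $x+y=0$ for all distinct $x,y$; $\mathbf{F}$ is the variety generated by all flat semirings. For a nonempty word $w$ in the free commutative semigroup over an alphabet $X$, $S_c(w)$ is the flat semiring whose elements are the nonempty subwords (that is, divisors) of $w$ and a new element $0$; the product of two words $u,v$ is $uv$ if $uv$ is a subword of $w$, all other products are $0$, and $x+x=x$, $x+y=0$ for $x\ne y$. Let $a,b,c$ be three distinct letters of $X$. Then: (1) $\mathsf{V}(S_c(abc))$ has exactly four subvarieties: $\mathsf{V}(S_c(abc))$, $\mathsf{V}(S_c(ab))$, $\mathsf{V}(S_c(a))$ and the trivial variety $\mathbf{T}$ of all one-element ai-semirings. They form a chain $$\mathbf{T}\subsetneq \mathsf{V}(S_c(a))\subsetneq \mathsf{V}(S_c(ab))\subsetneq \mathsf{V}(S_c(abc)),$$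 so the lattice of subvarieties of $\mathsf{V}(S_c(abc))$ is a $4$-element chain. (2) $\mathsf{V}(S_c(ab))$ is determined within $\mathbf{F}$ by the identities $xy\approx yx$, $x^2y\approx x^2$ and $x_1x_2x_3\approx y_1y_2y_3$; that is, it consists of exactly those members of $\mathbf{F}$ that satisfy these three identities. -/

import Mathlib

universe u

/-- An additively idempotent semiring, in the signature `{+, ·}` (no constants `0`, `1` are
required): `+` is a semilattice operation, `·` is associative, and `·` distributes over `+`. -/
class AISemiring (S : Type u) extends Distrib S, AddCommSemigroup S, Semigroup S where
  add_idem : ∀ x : S, x + x = x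

/-- Bundled (nonempty) ai-semirings. -/
structure AISrg : Type (u + 1) where
  carrier : Type u
  [inst : AISemiring carrier]
  [nonempty : Nonempty carrier]

namespace AISrg

instance : CoeSort AISrg.{u} (Type u) := ⟨AISrg.carrier⟩

instance (A : AISrg.{u}) : AISemiring A := A.inst

instance (A : AISrg.{u}) : Nonempty A := A.nonempty

/-- Direct products of ai-semirings, with componentwise operations. -/
instance piInst {I : Type u} (A : I → AISrg.{u}) : AISemiring (∀ i, A i) where
  add_assoc _ _ _ := funext fun _ => add_assoc _ _ _
  add_comm _ _ := funext fun _ => add_comm _ _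
  mul_assoc _ _ _ := funext fun _ => mul_assoc _ _ _
  left_distrib _ _ _ := funext fun _ => left_distrib _ _ _
  right_distrib _ _ _ := funext fun _ => right_distrib _ _ _
  add_idem _ := funext fun _ => AISemiring.add_idem _

/-- The direct product of a family of ai-semirings. -/
def prod {I : Type u} (A : I → AISrg.{u}) : AISrg.{u} := ⟨∀ i, A i⟩

/-- Homomorphisms of ai-semirings: maps preserving `+` and `·`. -/
def IsHom {A B : AISrg.{u}} (f : A → B) : Prop :=
  (∀ x y, f (x + y) = f x + f y) ∧ (∀ x y, f (x * y) = f x * f y)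

/-- A variety: a class of ai-semirings closed under homomorphic images, (isomorphic copies of)
subalgebras, and direct products. It is nonempty, as it contains the empty product. -/
structure IsVariety (V : Set AISrg.{u}) : Prop where
  homImage : ∀ (A B : AISrg.{u}) (f : A → B),
    IsHom f → Function.Surjective f → A ∈ V → B ∈ V
  subalgebra : ∀ (A B : AISrg.{u}) (f : B → A),
    IsHom f → Function.Injective f → A ∈ V → B ∈ V
  product : ∀ (I : Type u) (A : I → AISrg.{u}), (∀ i, A i ∈ V) → prod A ∈ V

/-- The variety generated by a class `K`: the intersection of all varieties containing `K`. -/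
def generatedVariety (K : Set AISrg.{u}) : Set AISrg.{u} :=
  {A | ∀ V : Set AISrg.{u}, IsVariety V → K ⊆ V → A ∈ V}

/-- The trivial variety: all one-element ai-semirings. -/
def trivialVariety : Set AISrg.{u} := {A | Subsingleton A}

/-- The subvarieties of `V`, ordered by inclusion. -/
abbrev Subvariety (V : Set AISrg.{u}) : Type (u + 1) :=
  {W : Set AISrg.{u} // IsVariety W ∧ W ⊆ V}

/-- Flat semirings: there is a multiplicative zero `o`, and `a + b = o` for all distinct `a`, `b`. -/
def IsFlat (A : AISrg.{u}) : Prop :=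
  ∃ o : A, (∀ a : A, o * a = o ∧ a * o = o) ∧ ∀ a b : A, a ≠ b → a + b = o

/-- The variety `F` generated by all flat semirings. -/
def flatVariety : Set AISrg.{u} := generatedVariety {A | IsFlat A}

end AISrg

/-- Words of the free commutative semigroup over `X` are nonempty multisets over `X`, the product
of words being the sum of multisets. `u` is a nonempty subword of a word in `W`. -/
def IsSubword {X : Type u} (W : Set (Multiset X)) (u : Multiset X) : Prop :=
  u ≠ 0 ∧ ∃ w ∈ W, u ≤ w

/-- The underlying set of `S_c(W)`: the nonempty subwords of words in `W`, with a new symbol. -/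
inductive Sc {X : Type u} (W : Set (Multiset X)) : Type u
  | zero : Sc W
  | word (u : Multiset X) (h : IsSubword W u) : Sc W

namespace Sc

variable {X : Type u} {W : Set (Multiset X)}

theorem isSubword_left {u v : Multiset X} (hu : u ≠ 0) (h : IsSubword W (u + v)) :
    IsSubword W u := by
  obtain ⟨-, w, hw, hle⟩ := h
  exact ⟨hu, w, hw, (Multiset.le_add_right u v).trans hle⟩

open Classical in
/-- The product of two words if it is again in `S_c(W)`, and `zero` in all other cases. -/
noncomputable instance : Mul (Sc W) where
  mul
    | word u _, word v _ => if h : IsSubword W (u + v) then word (u + v) h else zero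
    | _, _ => zero

open Classical in
/-- The flat addition: `x + x = x`, and `x + y` is `zero` for distinct `x`, `y`. -/
noncomputable instance : Add (Sc W) where
  add x y := if x = y then x else zero

@[simp] theorem add_self (x : Sc W) : x + x = x := if_pos rfl

theorem add_of_ne {x y : Sc W} (h : x ≠ y) : x + y = zero := if_neg h

@[simp] theorem zero_mul' (x : Sc W) : zero * x = zero := rfl

@[simp] theorem mul_zero' (x : Sc W) : x * zero = zero := by cases x <;> rfl

theorem word_mul_word {u v : Multiset X} (hu : IsSubword W u) (hv : IsSubword W v)
    (h : IsSubword W (u + v)) : word u hu * word v hv = word (u + v) h := dif_pos h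

theorem word_mul_word_of_not {u v : Multiset X} (hu : IsSubword W u) (hv : IsSubword W v)
    (h : ¬ IsSubword W (u + v)) : word u hu * word v hv = zero := dif_neg h

protected theorem mul_comm' (x y : Sc W) : x * y = y * x := by
  cases x with
  | zero => simp
  | word u hu =>
    cases y with
    | zero => simp
    | word v hv =>
      by_cases h : IsSubword W (u + v)
      · rw [word_mul_word hu hv h, word_mul_word hv hu (add_comm u v ▸ h)]
        simp only [add_comm u v]
      · rw [word_mul_word_of_not hu hv h, word_mul_word_of_not hv hu (add_comm u v ▸ h)]

protected theorem mul_assoc' (x y z : Sc W) : x * y * z = x * (y * z) := by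
  cases x with
  | zero => simp
  | word u hu =>
  cases y with
  | zero => simp
  | word v hv =>
  cases z with
  | zero => simp
  | word t ht =>
  by_cases h : IsSubword W (u + v + t)
  · have h1 : IsSubword W (u + v) := isSubword_left (by simp [hu.1]) h
    have h' : IsSubword W (u + (v + t)) := add_assoc u v t ▸ h
    have h2 : IsSubword W (v + t) := isSubword_left (v := u) (by simp [hv.1])
      (add_comm u (v + t) ▸ h')
    rw [word_mul_word _ _ h1, word_mul_word _ _ h, word_mul_word _ _ h2, word_mul_word _ _ h']
    simp only [add_assoc]
  · have h' : ¬ IsSubword W (u + (v + t)) := add_assoc u v t ▸ h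
    have e1 : word u hu * word v hv * word t ht = zero := by
      by_cases h1 : IsSubword W (u + v)
      · rw [word_mul_word _ _ h1, word_mul_word_of_not _ _ h]
      · rw [word_mul_word_of_not _ _ h1, zero_mul']
    have e2 : word u hu * (word v hv * word t ht) = zero := by
      by_cases h2 : IsSubword W (v + t)
      · rw [word_mul_word _ _ h2, word_mul_word_of_not _ _ h']
      · rw [word_mul_word_of_not _ _ h2, mul_zero']
    rw [e1, e2]

/-- The multiplication is `0`-cancellative. -/
theorem eq_of_mul_eq {x y z : Sc W} (h : x * y = x * z) (h0 : x * y ≠ zero) : y = z := by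
  cases x with
  | zero => simp at h0
  | word u hu =>
  cases y with
  | zero => simp at h0
  | word v hv =>
  cases z with
  | zero => rw [mul_zero'] at h; exact absurd h h0
  | word t ht =>
  by_cases h1 : IsSubword W (u + v)
  · by_cases h2 : IsSubword W (u + t)
    · rw [word_mul_word _ _ h1, word_mul_word _ _ h2] at h
      simpa using h
    · rw [word_mul_word_of_not _ _ h2] at h; exact absurd h h0
  · exact absurd (word_mul_word_of_not _ _ h1) h0

protected theorem left_distrib' (x y z : Sc W) : x * (y + z) = x * y + x * z := by
  by_cases h : y = z
  · simp [h]
  · rw [add_of_ne h, mul_zero']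
    by_cases h' : x * y = x * z
    · by_cases h0 : x * y = zero
      · rw [← h', h0, add_self]
      · exact absurd (eq_of_mul_eq h' h0) h
    · rw [add_of_ne h']

protected theorem add_comm' (x y : Sc W) : x + y = y + x := by
  by_cases h : x = y
  · rw [h]
  · rw [add_of_ne h, add_of_ne (Ne.symm h)]

theorem zero_add' (x : Sc W) : zero + x = zero := by
  by_cases h : zero = x
  · rw [← h, add_self]
  · exact add_of_ne h

protected theorem add_assoc' (x y z : Sc W) : x + y + z = x + (y + z) := by
  by_cases h : x = y
  · subst h
    by_cases h2 : x = z
    · subst h2; simp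
    · rw [add_self, add_of_ne h2, Sc.add_comm', zero_add']
  · rw [add_of_ne h, zero_add']
    by_cases h2 : y = z
    · subst h2; rw [add_self, add_of_ne h]
    · rw [add_of_ne h2, Sc.add_comm', zero_add']

noncomputable instance : AISemiring (Sc W) where
  add_assoc := Sc.add_assoc'
  add_comm := Sc.add_comm'
  mul_assoc := Sc.mul_assoc'
  left_distrib := Sc.left_distrib'
  right_distrib x y z := by
    rw [Sc.mul_comm' (x + y) z, Sc.left_distrib', Sc.mul_comm' x z, Sc.mul_comm' y z]
  add_idem := add_self

instance : Nonempty (Sc W) := ⟨zero⟩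

end Sc

/-- The flat semiring `S_c(w)` of a single commutative word `w`. -/
noncomputable def ScWord {X : Type u} (w : Multiset X) : AISrg.{u} := ⟨Sc {w}⟩

/-- The variety `V(S_c(w))` generated by `S_c(w)`. -/
def varietySc {X : Type u} (w : Multiset X) : Set AISrg.{u} := AISrg.generatedVariety {ScWord w}

/-! Everything reduces to flat semirings. Order an ai-semiring by `x ≤ p` iff `x + p = p`. Flat
semirings, hence all members of `F`, satisfy `ContextIdentities`: elements sharing one context `u·_`
below `p` share all of them. The syntactic congruence of `p` therefore has a flat quotient
(`exists_flat_quotient`), and a commutative member of `F` with an absorbing element `c` embeds in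
the product of these quotients over `p ≠ c` (`mem_of_separating`).

In `V(S_c(abc))` all squares equal the absorbing element `c`. If a subvariety contains an algebra
with some `xyz ≠ c`, the flat quotient at `xyz` contains a copy of `S_c(abc)`
(`scWord_mem_of_prod_ne`). Otherwise `xyz` is constant and part (2) places the subvariety inside
`V(S_c(ab))`. The same dichotomy for `xy`, and then for `x`, yields the chain.

For part (2), a flat quotient with `x² = xyz = 0` whose nonzero elements divide `p` consists of `0`,
`p` and pairs of distinct cofactors `{x, y}` with `xy = p`. Sending `p` to `ab` and the members of
each pair to `a` and `b`, in all possible ways, represents it inside a power of `S_c(ab)`, up to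
collapsing the tuples with a zero coordinate (`mem_of_partialHoms`, `flat_mem_of_nilpotent`). -/

/-! ### Identities and generated varieties -/

/-- Terms in the signature `{+, ·}` over countably many variables. -/
inductive AITerm : Type
  | var (n : ℕ) : AITerm
  | add (s t : AITerm) : AITerm
  | mul (s t : AITerm) : AITerm

namespace AITerm

/-- The value of a term under an assignment of the variables. -/
def eval {A : Type u} [AISemiring A] (v : ℕ → A) : AITerm → A
  | var n => v n
  | add s t => eval v s + eval v t
  | mul s t => eval v s * eval v t

theorem eval_hom {A B : AISrg.{u}} {f : A → B} (hf : AISrg.IsHom f) (v : ℕ → A) (t : AITerm) :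
    eval (fun n => f (v n)) t = f (eval v t) := by
  induction t with
  | var n => rfl
  | add s t hs ht => simp only [eval, hs, ht, hf.1]
  | mul s t hs ht => simp only [eval, hs, ht, hf.2]

end AITerm

namespace AISrg

theorem isHom_proj {I : Type u} (A : I → AISrg.{u}) (i : I) :
    IsHom (A := prod A) (B := A i) (fun x => x i) :=
  ⟨fun _ _ => rfl, fun _ _ => rfl⟩

/-- The models of an identity form a variety. -/
theorem isVariety_identity (s t : AITerm) :
    IsVariety {A : AISrg.{u} | ∀ v : ℕ → A, s.eval v = t.eval v} where
  homImage A B f hf hs hA v := by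
    choose g hg using hs
    have e : v = fun n => f (g (v n)) := funext fun n => (hg _).symm
    rw [e, AITerm.eval_hom hf, AITerm.eval_hom hf, hA]
  subalgebra A B f hf hi hA v := hi <| by
    rw [← AITerm.eval_hom hf, ← AITerm.eval_hom hf, hA]
  product I A hA v := funext fun i => by
    have h := hA i (fun n => v n i)
    exact (AITerm.eval_hom (isHom_proj A i) v s).symm.trans
      (h.trans (AITerm.eval_hom (isHom_proj A i) v t))

theorem isVariety_generatedVariety (K : Set AISrg.{u}) : IsVariety (generatedVariety K) where
  homImage A B f hf hs hA V hV hK := hV.homImage A B f hf hs (hA V hV hK)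
  subalgebra A B f hf hi hA V hV hK := hV.subalgebra A B f hf hi (hA V hV hK)
  product I A hA V hV hK := hV.product I A fun i => hA i V hV hK

theorem subset_generatedVariety (K : Set AISrg.{u}) : K ⊆ generatedVariety K :=
  fun _ hA _ _ hK => hK hA

theorem generatedVariety_subset {K V : Set AISrg.{u}} (hV : IsVariety V) (h : K ⊆ V) :
    generatedVariety K ⊆ V :=
  fun _ hA => hA V hV h

theorem identity_of_mem_generatedVariety {K : Set AISrg.{u}} (s t : AITerm)
    (h : ∀ A ∈ K, ∀ v : ℕ → A, s.eval v = t.eval v) {A : AISrg.{u}}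
    (hA : A ∈ generatedVariety K) (v : ℕ → A) : s.eval v = t.eval v :=
  generatedVariety_subset (isVariety_identity s t) h hA v

theorem isVariety_trivialVariety : IsVariety trivialVariety.{u} where
  homImage A B f hf hs (hA : Subsingleton A) := hs.subsingleton
  subalgebra A B f hf hi (hA : Subsingleton A) := hi.subsingleton
  product I A hA := by
    have (i : I) : Subsingleton (A i) := hA i
    exact (inferInstance : Subsingleton (∀ i, A i))

/-- A one-element algebra embeds in the empty product. -/
theorem trivialVariety_subset {V : Set AISrg.{u}} (hV : IsVariety V) : trivialVariety ⊆ V := by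
  intro A (hA : Subsingleton A)
  refine hV.subalgebra (prod (fun i : PEmpty.{u + 1} => i.elim)) A (fun _ i => i.elim)
    ⟨fun _ _ => funext fun i => i.elim, fun _ _ => funext fun i => i.elim⟩
    (fun _ _ _ => Subsingleton.elim _ _) (hV.product _ _ fun i => i.elim)

end AISrg

/-! ### Flat semirings -/

/-- `o` is a multiplicative zero, and the sum of any two distinct elements is `o`. -/
structure IsFlatZero {A : Type u} [AISemiring A] (o : A) : Prop where
  zero_mul : ∀ x, o * x = o
  mul_zero : ∀ x, x * o = o
  add_of_ne : ∀ x y : A, x ≠ y → x + y = o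

/-- An element which absorbs under both operations. -/
structure IsAbsorbing {A : Type u} [AISemiring A] (o : A) : Prop where
  zero_mul : ∀ x, o * x = o
  mul_zero : ∀ x, x * o = o
  zero_add : ∀ x, o + x = o

namespace IsFlatZero

variable {A : Type u} [AISemiring A] {o : A}

theorem zero_add (h : IsFlatZero o) (x : A) : o + x = o := by
  by_cases e : o = x
  · rw [← e, AISemiring.add_idem]
  · exact h.add_of_ne _ _ e

theorem add_zero (h : IsFlatZero o) (x : A) : x + o = o := by
  rw [add_comm, h.zero_add]

theorem mul_left_cancel (h : IsFlatZero o) {x y z : A} (e : x * y = x * z) (h0 : x * y ≠ o) :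
    y = z := by
  by_contra hne
  apply h0
  rw [← h.mul_zero x, ← h.add_of_ne _ _ hne, left_distrib, ← e, AISemiring.add_idem]

end IsFlatZero

/-- The action of a context, that is, of an optional left factor. -/
def contextAct {A : Type u} [Mul A] : Option A → A → A
  | none, x => x
  | some u, x => u * x

/-- The identities `wx + wy + ux + uy ≈ wx + wy + ux`, where `u` and `w` may be empty. -/
def ContextIdentities (A : Type u) [AISemiring A] : Prop :=
  ∀ (w u : Option A) (x y : A),
    contextAct w x + contextAct w y + contextAct u x + contextAct u y =
      contextAct w x + contextAct w y + contextAct u x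

theorem contextAct_add {A : Type u} [AISemiring A] (u : Option A) (x y : A) :
    contextAct u (x + y) = contextAct u x + contextAct u y := by
  cases u with
  | none => rfl
  | some u => exact left_distrib u x y

theorem IsFlatZero.contextAct_zero {A : Type u} [AISemiring A] {o : A} (h : IsFlatZero o)
    (u : Option A) : contextAct u o = o := by
  cases u with
  | none => rfl
  | some u => exact h.mul_zero u

/-- For `x = y` the last summand repeats the one before it. For `x ≠ y` the first two summands
already give `w(x + y) = wo = o`, which absorbs the rest. -/
theorem IsFlatZero.contextIdentities {A : Type u} [AISemiring A] {o : A} (h : IsFlatZero o) :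
    ContextIdentities A := by
  intro w u x y
  by_cases e : x = y
  · subst e
    rw [add_assoc _ (contextAct u x), AISemiring.add_idem (contextAct u x)]
  · rw [← contextAct_add, h.add_of_ne _ _ e, h.contextAct_zero, h.zero_add, h.zero_add]

namespace AISrg

-- An optional factor is not part of a term, so each of the four empty/nonempty combinations is
-- transferred as its own identity; with both contexts empty it holds in every ai-semiring.
open AITerm in
theorem contextIdentities_of_mem_flatVariety {A : AISrg.{u}} (hA : A ∈ flatVariety) :
    ContextIdentities A := by
  have key (B : AISrg.{u}) (hB : IsFlat B) : ContextIdentities B := by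
    obtain ⟨o, h1, h2⟩ := hB
    exact IsFlatZero.contextIdentities (o := o) ⟨fun x => (h1 x).1, fun x => (h1 x).2, h2⟩
  intro w u x y
  rcases w with _ | w <;> rcases u with _ | u
  · show x + y + x + y = x + y + x
    rw [add_right_comm x y x, AISemiring.add_idem, add_assoc, AISemiring.add_idem]
  · exact identity_of_mem_generatedVariety
      (add (add (add (var 0) (var 1)) (mul (var 2) (var 0))) (mul (var 2) (var 1)))
      (add (add (var 0) (var 1)) (mul (var 2) (var 0)))
      (fun B hB v => key B hB none (some (v 2)) (v 0) (v 1)) hA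
      (fun | 0 => x | 1 => y | _ => u)
  · exact identity_of_mem_generatedVariety
      (add (add (add (mul (var 2) (var 0)) (mul (var 2) (var 1))) (var 0)) (var 1))
      (add (add (mul (var 2) (var 0)) (mul (var 2) (var 1))) (var 0))
      (fun B hB v => key B hB (some (v 2)) none (v 0) (v 1)) hA
      (fun | 0 => x | 1 => y | _ => w)
  · exact identity_of_mem_generatedVariety
      (add (add (add (mul (var 3) (var 0)) (mul (var 3) (var 1))) (mul (var 2) (var 0)))
        (mul (var 2) (var 1)))
      (add (add (mul (var 3) (var 0)) (mul (var 3) (var 1))) (mul (var 2) (var 0)))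
      (fun B hB v => key B hB (some (v 3)) (some (v 2)) (v 0) (v 1)) hA
      (fun | 0 => x | 1 => y | 2 => u | _ => w)

end AISrg

/-- Taking `w = c`, `u` empty and the pair `c, x`, the identity collapses to `c + x = c`. -/
theorem ContextIdentities.isAbsorbing {A : Type u} [AISemiring A] (hA : ContextIdentities A)
    {c : A} (h1 : ∀ x, c * x = c) (h2 : ∀ x, x * c = c) : IsAbsorbing c := by
  refine ⟨h1, h2, fun x => ?_⟩
  have h := hA (some c) none c x
  simpa only [contextAct, h1, AISemiring.add_idem] using h

/-! ### Syntactic quotients -/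

/-- The order of an ai-semiring. -/
def IsBelow {A : Type u} [Add A] (x p : A) : Prop := x + p = p

section Below

variable {A : Type u} [AISemiring A]

theorem IsBelow.refl (x : A) : IsBelow x x := AISemiring.add_idem x

theorem isBelow_add_iff {x y p : A} : IsBelow (x + y) p ↔ IsBelow x p ∧ IsBelow y p := by
  unfold IsBelow
  constructor
  · intro h
    constructor
    · rw [← h, ← add_assoc, ← add_assoc, AISemiring.add_idem]
    · rw [← h, add_comm x y, ← add_assoc, ← add_assoc, AISemiring.add_idem]
  · rintro ⟨h1, h2⟩
    rw [add_assoc, h2, h1]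

theorem IsBelow.antisymm {x y : A} (h1 : IsBelow x y) (h2 : IsBelow y x) : x = y := by
  unfold IsBelow at h1 h2
  rw [← h2, add_comm, h1]

theorem IsAbsorbing.not_isBelow {c : A} (h : IsAbsorbing c) {p : A} (hp : p ≠ c) :
    ¬ IsBelow c p := fun e => hp ((h.zero_add p).symm.trans e).symm

/-- The form in which the identities are used: a common context `w` of `x` and `y` below `p` carries
every other context of `x` over to `y`. -/
theorem ContextIdentities.isBelow (hA : ContextIdentities A) {w u : Option A} {x y p : A}
    (h1 : IsBelow (contextAct w x) p) (h2 : IsBelow (contextAct w y) p)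
    (h3 : IsBelow (contextAct u x) p) : IsBelow (contextAct u y) p := by
  have h := hA w u x y
  have : IsBelow (contextAct w x + contextAct w y + contextAct u x + contextAct u y) p := by
    rw [h]
    exact isBelow_add_iff.2 ⟨isBelow_add_iff.2 ⟨h1, h2⟩, h3⟩
  exact (isBelow_add_iff.1 this).2

/-- Two elements are equivalent if they have the same contexts below `p`. -/
def contextSetoid (p : A) : Setoid A where
  r x y := ∀ u : Option A, IsBelow (contextAct u x) p ↔ IsBelow (contextAct u y) p
  iseqv := ⟨fun _ _ => Iff.rfl, fun h u => (h u).symm, fun h k u => (h u).trans (k u)⟩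

theorem contextSetoid_add {p x x' y y' : A} (hx : contextSetoid p x x')
    (hy : contextSetoid p y y') : contextSetoid p (x + y) (x' + y') := fun u => by
  rw [contextAct_add, contextAct_add, isBelow_add_iff, isBelow_add_iff, hx u, hy u]

/-- Every context `u` of `y * x` is the context `u * y` of `x`, the empty one becoming `y`. Right
factors then follow by commutativity. -/
theorem contextSetoid_mul_left {p x x' : A}
    (hx : contextSetoid p x x') (y : A) : contextSetoid p (y * x) (y * x') := by
  rintro (_ | u)
  · exact hx (some y)
  · have := hx (some (u * y))
    simpa only [contextAct, mul_assoc] using this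

theorem contextSetoid_mul {p x x' y y' : A} (hc : ∀ x y : A, x * y = y * x)
    (hx : contextSetoid p x x') (hy : contextSetoid p y y') :
    contextSetoid p (x * y) (x' * y') := by
  refine (contextSetoid p).trans (contextSetoid_mul_left hy x) ?_
  rw [hc x, hc x']
  exact contextSetoid_mul_left hx y'

end Below

/-- The quotient of a commutative ai-semiring by the congruence `contextSetoid p`. -/
def contextQuotient (A : AISrg.{u}) (hc : ∀ x y : A, x * y = y * x) (p : A) : AISrg.{u} :=
  letI : Add (Quotient (contextSetoid p)) :=
    ⟨Quotient.map₂ (· + ·) fun _ _ hx _ _ hy => contextSetoid_add hx hy⟩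
  letI : Mul (Quotient (contextSetoid p)) :=
    ⟨Quotient.map₂ (· * ·) fun _ _ hx _ _ hy => contextSetoid_mul hc hx hy⟩
  @AISrg.mk (Quotient (contextSetoid p))
    { add_assoc := by
        rintro ⟨x⟩ ⟨y⟩ ⟨z⟩; exact congrArg (Quotient.mk _) (add_assoc x y z)
      add_comm := by
        rintro ⟨x⟩ ⟨y⟩; exact congrArg (Quotient.mk _) (add_comm x y)
      mul_assoc := by
        rintro ⟨x⟩ ⟨y⟩ ⟨z⟩; exact congrArg (Quotient.mk _) (mul_assoc x y z)
      left_distrib := by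
        rintro ⟨x⟩ ⟨y⟩ ⟨z⟩; exact congrArg (Quotient.mk _) (left_distrib x y z)
      right_distrib := by
        rintro ⟨x⟩ ⟨y⟩ ⟨z⟩; exact congrArg (Quotient.mk _) (right_distrib x y z)
      add_idem := by
        rintro ⟨x⟩; exact congrArg (Quotient.mk _) (AISemiring.add_idem x) }
    ((inferInstance : Nonempty A).map (Quotient.mk _))

/-- For `p` other than the absorbing element `c`, the syntactic quotient at `p` is flat. In it, the
class of `p` is the set of elements below `p`, and every nonzero element divides this class. -/
theorem exists_flat_quotient {A : AISrg.{u}} (hA : ContextIdentities A)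
    (hc : ∀ x y : A, x * y = y * x) {c : A} (h0 : IsAbsorbing c) {p : A} (hp : p ≠ c) :
    ∃ (Q : AISrg.{u}) (f : A → Q), AISrg.IsHom f ∧ Function.Surjective f ∧
      IsFlatZero (f c) ∧ (∀ q, f q = f p → IsBelow q p) ∧
      ∀ x, f x ≠ f c → f x = f p ∨ ∃ u, f (u * x) = f p := by
  have hcp := h0.not_isBelow hp
  have hctx (u : Option A) : contextAct u c = c := by
    cases u with
    | none => rfl
    | some u => exact h0.mul_zero u
  -- The class of `c` is the class of elements without any context below `p`.
  have hnone {x : A} (hx : ¬ ∃ u, IsBelow (contextAct u x) p) : contextSetoid p x c := fun u =>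
    ⟨fun h => absurd ⟨u, h⟩ hx, fun h => absurd (hctx u ▸ h) hcp⟩
  -- Such an `x` shares the empty context with `p`, hence all contexts.
  have hbelow {x : A} (hx : IsBelow x p) : contextSetoid p x p := fun u =>
    ⟨hA.isBelow (w := none) hx (IsBelow.refl p), hA.isBelow (w := none) (IsBelow.refl p) hx⟩
  refine ⟨contextQuotient A hc p, Quotient.mk (contextSetoid p),
    ⟨fun _ _ => rfl, fun _ _ => rfl⟩, Quotient.mk_surjective, ⟨?_, ?_, ?_⟩, ?_, ?_⟩
  · rintro ⟨x⟩; exact congrArg (Quotient.mk _) (h0.zero_mul x)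
  · rintro ⟨x⟩; exact congrArg (Quotient.mk _) (h0.mul_zero x)
  · rintro ⟨x⟩ ⟨y⟩ hxy
    -- A context of `x + y` below `p` would be common to `x` and `y`, forcing their classes to
    -- coincide.
    refine Quotient.sound (hnone ?_)
    rintro ⟨w, hw⟩
    rw [contextAct_add, isBelow_add_iff] at hw
    exact hxy (Quotient.sound fun u => ⟨hA.isBelow hw.1 hw.2, hA.isBelow hw.2 hw.1⟩)
  · intro q hq
    exact ((Quotient.exact hq : contextSetoid p q p) none).2 (IsBelow.refl p)
  · intro x hx
    by_cases h : ∃ u, IsBelow (contextAct u x) p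
    · obtain ⟨_ | u, h⟩ := h
      · exact Or.inl (Quotient.sound (hbelow h))
      · exact Or.inr ⟨u, Quotient.sound (hbelow h)⟩
    · exact absurd (Quotient.sound (hnone h)) hx

/-! ### The semirings `S_c(w)` -/

namespace Sc

variable {X : Type u} {W : Set (Multiset X)}

theorem isFlatZero : IsFlatZero (zero : Sc W) :=
  ⟨zero_mul', mul_zero', fun _ _ => add_of_ne⟩

theorem exists_of_mul_ne_zero {x y : Sc W} (h : x * y ≠ zero) :
    ∃ u v hu hv huv, x = word u hu ∧ y = word v hv ∧ x * y = word (u + v) huv := by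
  cases x with
  | zero => exact absurd (zero_mul' y) h
  | word u hu =>
    cases y with
    | zero => exact absurd (mul_zero' _) h
    | word v hv =>
      by_cases huv : IsSubword W (u + v)
      · exact ⟨u, v, hu, hv, huv, rfl, rfl, word_mul_word hu hv huv⟩
      · exact absurd (word_mul_word_of_not hu hv huv) h

theorem isSubword_singleton {w u : Multiset X} : IsSubword {w} u ↔ u ≠ 0 ∧ u ≤ w := by
  simp [IsSubword]

/-- A letter of `u` would occur twice in the multilinear word `w`. -/
theorem mul_self_eq_zero {w : Multiset X} (hw : w.Nodup) (x : Sc {w}) : x * x = zero := by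
  by_contra h
  obtain ⟨u, v, hu, hv, huv, h1, h2, -⟩ := exists_of_mul_ne_zero h
  obtain rfl : u = v := by simpa using h1.symm.trans h2
  obtain ⟨a, ha⟩ := Multiset.exists_mem_of_ne_zero hu.1
  have hle := (isSubword_singleton.1 huv).2
  exact (Multiset.disjoint_left.1 (Multiset.nodup_add.1 (Multiset.nodup_of_le hle hw)).2.2) ha ha

theorem mul_eq_zero_of_card {w : Multiset X} (hw : w.card ≤ 1) (x y : Sc {w}) :
    x * y = zero := by
  by_contra h
  obtain ⟨u, v, hu, hv, huv, -, -, -⟩ := exists_of_mul_ne_zero h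
  have h1 := Multiset.card_pos.2 hu.1
  have h2 := Multiset.card_pos.2 hv.1
  have h3 := Multiset.card_le_card (isSubword_singleton.1 huv).2
  rw [Multiset.card_add] at h3
  omega

theorem mul_mul_eq_zero_of_card {w : Multiset X} (hw : w.card ≤ 2) (x y z : Sc {w}) :
    x * y * z = zero := by
  by_contra h
  obtain ⟨t, r, ht, hr, htr, e, -, -⟩ := exists_of_mul_ne_zero h
  obtain ⟨u, v, hu, hv, huv, -, -, e'⟩ := exists_of_mul_ne_zero (x := x) (y := y) (by simp [e])
  obtain rfl : t = u + v := by simpa using e.symm.trans e'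
  have h1 := Multiset.card_pos.2 hu.1
  have h2 := Multiset.card_pos.2 hv.1
  have h4 := Multiset.card_pos.2 hr.1
  have h3 := Multiset.card_le_card (isSubword_singleton.1 htr).2
  rw [Multiset.card_add, Multiset.card_add] at h3
  omega

end Sc

/-! ### Identities holding in `V(S_c(w))` -/

section VarietySc

variable {X : Type u}

theorem isVariety_varietySc (w : Multiset X) : AISrg.IsVariety (varietySc w) :=
  AISrg.isVariety_generatedVariety _

theorem scWord_mem_varietySc (w : Multiset X) : ScWord w ∈ varietySc w :=
  AISrg.subset_generatedVariety _ rfl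

theorem varietySc_subset {w : Multiset X} {V : Set AISrg.{u}} (hV : AISrg.IsVariety V)
    (h : ScWord w ∈ V) : varietySc w ⊆ V :=
  AISrg.generatedVariety_subset hV (Set.singleton_subset_iff.2 h)

theorem identity_of_mem_varietySc {w : Multiset X} (s t : AITerm)
    (h : ∀ v : ℕ → Sc {w}, s.eval v = t.eval v) {A : AISrg.{u}} (hA : A ∈ varietySc w)
    (v : ℕ → A) : s.eval v = t.eval v := by
  refine AISrg.identity_of_mem_generatedVariety s t ?_ hA v
  rintro _ rfl
  exact h

theorem varietySc_subset_flatVariety (w : Multiset X) : varietySc w ⊆ AISrg.flatVariety := by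
  refine varietySc_subset (AISrg.isVariety_generatedVariety _)
    (AISrg.subset_generatedVariety _ ⟨Sc.zero, fun a => ?_, fun a b h => ?_⟩)
  · exact ⟨Sc.zero_mul' a, Sc.mul_zero' a⟩
  · exact Sc.add_of_ne h

open AITerm

theorem mul_comm_of_mem_varietySc {w : Multiset X} {A : AISrg.{u}} (hA : A ∈ varietySc w)
    (x y : A) : x * y = y * x :=
  identity_of_mem_varietySc (mul (var 0) (var 1)) (mul (var 1) (var 0))
    (fun v => Sc.mul_comm' (v 0) (v 1)) hA (fun | 0 => x | _ => y)

theorem mul_self_mul_of_mem_varietySc {w : Multiset X} (hw : w.Nodup) {A : AISrg.{u}}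
    (hA : A ∈ varietySc w) (x y : A) : x * x * y = x * x :=
  identity_of_mem_varietySc (mul (mul (var 0) (var 0)) (var 1)) (mul (var 0) (var 0))
    (fun v => by simp only [eval, Sc.mul_self_eq_zero hw, Sc.zero_mul']) hA
    (fun | 0 => x | _ => y)

theorem mul_self_eq_of_mem_varietySc {w : Multiset X} (hw : w.Nodup) {A : AISrg.{u}}
    (hA : A ∈ varietySc w) (x y : A) : x * x = y * y :=
  identity_of_mem_varietySc (mul (var 0) (var 0)) (mul (var 1) (var 1))
    (fun v => by simp only [eval, Sc.mul_self_eq_zero hw]) hA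
    (fun | 0 => x | _ => y)

theorem mul_eq_of_mem_varietySc {w : Multiset X} (hw : w.card ≤ 1) {A : AISrg.{u}}
    (hA : A ∈ varietySc w) (x₁ x₂ y₁ y₂ : A) : x₁ * x₂ = y₁ * y₂ :=
  identity_of_mem_varietySc (mul (var 0) (var 1)) (mul (var 2) (var 3))
    (fun v => by simp only [eval, Sc.mul_eq_zero_of_card hw]) hA
    (fun | 0 => x₁ | 1 => x₂ | 2 => y₁ | _ => y₂)

theorem mul_mul_eq_of_mem_varietySc {w : Multiset X} (hw : w.card ≤ 2) {A : AISrg.{u}}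
    (hA : A ∈ varietySc w) (x₁ x₂ x₃ y₁ y₂ y₃ : A) : x₁ * x₂ * x₃ = y₁ * y₂ * y₃ :=
  identity_of_mem_varietySc (mul (mul (var 0) (var 1)) (var 2)) (mul (mul (var 3) (var 4)) (var 5))
    (fun v => by simp only [eval, Sc.mul_mul_eq_zero_of_card hw]) hA
    (fun | 0 => x₁ | 1 => x₂ | 2 => x₃ | 3 => y₁ | 4 => y₂ | _ => y₃)

end VarietySc

/-! ### Embedding `S_c(w)` into flat semirings -/

/-- Let `Q` be a flat commutative semiring with `x² ≈ 0`. If the value of a multilinear word `w`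
under some assignment is not zero, then `S_c(w)` embeds into `Q`. -/
theorem scWord_mem_of_prod_ne {X : Type u} {w : Multiset X} (hw : w.Nodup) {Q : AISrg.{u}}
    {V : Set AISrg.{u}} (hV : AISrg.IsVariety V) (hQ : Q ∈ V) (hc : ∀ x y : Q, x * y = y * x)
    {o : Q} (ho : IsFlatZero o) (hsq : ∀ x : Q, x * x = o) (φ : X → Q)
    (hφ : letI : CommSemigroup Q := { (inferInstance : Semigroup Q) with mul_comm := hc }
      (w.map fun x => (φ x : WithOne Q)).prod ≠ (o : WithOne Q)) :
    ScWord w ∈ V := by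
  classical
  let _ : CommSemigroup Q := { (inferInstance : Semigroup Q) with mul_comm := hc }
  have hφ' : (w.map fun x => (φ x : WithOne Q)).prod ≠ (o : WithOne Q) := hφ
  clear hφ
  -- Evaluation of words; the adjoined unit is the value of the empty word.
  set π : Multiset X → WithOne Q := fun u => (u.map fun x => (φ x : WithOne Q)).prod with hπ
  have hadd (u v : Multiset X) : π (u + v) = π u * π v := by simp [hπ]
  have hzero (r : WithOne Q) : (o : WithOne Q) * r = o := by
    by_cases h : r = 1
    · rw [h, mul_one]
    · obtain ⟨r, rfl⟩ := WithOne.ne_one_iff_exists.1 h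
      rw [← WithOne.coe_mul, ho.zero_mul]
  have hval (u : Multiset X) (hu : u ≠ 0) : ∃ q : Q, (q : WithOne Q) = π u := by
    refine WithOne.ne_one_iff_exists.1 ?_
    obtain ⟨x, hx⟩ := Multiset.exists_mem_of_ne_zero hu
    obtain ⟨t, rfl⟩ := Multiset.exists_cons_of_mem hx
    have e : π (x ::ₘ t) = (φ x : WithOne Q) * π t := by simp [hπ]
    rw [e]
    by_cases h : π t = 1
    · rw [h, mul_one]; exact WithOne.coe_ne_one
    · obtain ⟨r, hr⟩ := WithOne.ne_one_iff_exists.1 h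
      rw [← hr, ← WithOne.coe_mul]; exact WithOne.coe_ne_one
  -- A shared letter contributes a square, which is `o`.
  have hrep {u v : Multiset X} {x : X} (hu : x ∈ u) (hv : x ∈ v) : π u * π v = o := by
    obtain ⟨s, rfl⟩ := Multiset.exists_cons_of_mem hu
    obtain ⟨t, rfl⟩ := Multiset.exists_cons_of_mem hv
    have e (t : Multiset X) : π (x ::ₘ t) = (φ x : WithOne Q) * π t := by simp [hπ]
    rw [e, e, mul_mul_mul_comm, ← WithOne.coe_mul, hsq, hzero]
  have hne {u : Multiset X} (hu : u ≤ w) : π u ≠ o := fun e => hφ' <| by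
    obtain ⟨v, rfl⟩ := Multiset.le_iff_exists_add.1 hu
    exact (hadd u v).trans (by rw [e, hzero])
  -- Injectivity on divisors of `w = v + t`: a letter of `u` missing from `v` lies in `t`, so `π w =
  -- π u * π t` would be `o`.
  have hmem {u v : Multiset X} (hu : u ≤ w) (hv : v ≤ w) (e : π u = π v) : u ≤ v := by
    refine (Multiset.le_iff_subset (Multiset.nodup_of_le hu hw)).2 fun x hx => ?_
    by_contra hxv
    obtain ⟨t, rfl⟩ := Multiset.le_iff_exists_add.1 hv
    have hxt : x ∈ t := (Multiset.mem_add.1 (Multiset.mem_of_le hu hx)).resolve_left hxv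
    exact hφ' ((hadd v t).trans (by rw [← e, hrep hx hxt]))
  choose val hvalπ using hval
  let f : ScWord w → Q := fun x => match (x : Sc {w}) with
    | Sc.zero => o
    | Sc.word u h => val u h.1
  have f_zero : f Sc.zero = o := rfl
  have f_word (u : Multiset X) (h : IsSubword {w} u) : f (Sc.word u h) = val u h.1 := rfl
  have f_ne (u : Multiset X) (h : IsSubword {w} u) : f (Sc.word u h) ≠ o := fun e =>
    hne (Sc.isSubword_singleton.1 h).2 (by rw [← hvalπ u h.1, ← f_word u h, e])
  have hinj : Function.Injective f := by
    rintro (_ | ⟨u, hu⟩) (_ | ⟨v, hv⟩) e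
    · rfl
    · exact absurd e.symm (f_ne v hv)
    · exact absurd e (f_ne u hu)
    · have e' : π u = π v := by rw [← hvalπ u hu.1, ← hvalπ v hv.1, ← f_word u hu, e, f_word v hv]
      have hu' := (Sc.isSubword_singleton.1 hu).2
      have hv' := (Sc.isSubword_singleton.1 hv).2
      obtain rfl := le_antisymm (hmem hu' hv' e') (hmem hv' hu' e'.symm)
      rfl
  refine hV.subalgebra Q (ScWord w) f ⟨fun x y => ?_, fun x y => ?_⟩ hinj hQ
  · by_cases e : x = y
    · rw [e, AISemiring.add_idem, AISemiring.add_idem]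
    · rw [ho.add_of_ne _ _ (hinj.ne e)]
      exact congrArg f (Sc.add_of_ne e)
  · rcases x with _ | ⟨u, hu⟩
    · exact (congrArg f (Sc.zero_mul' y)).trans (ho.zero_mul _).symm
    rcases y with _ | ⟨v, hv⟩
    · exact (congrArg f (Sc.mul_zero' (Sc.word u hu))).trans (ho.mul_zero _).symm
    by_cases h : IsSubword {w} (u + v)
    · refine (congrArg f (Sc.word_mul_word hu hv h)).trans ?_
      rw [f_word _ h, f_word _ hu, f_word _ hv]
      apply WithOne.coe_injective
      rw [hvalπ, hadd]
      exact (congrArg₂ (· * ·) (hvalπ u hu.1) (hvalπ v hv.1)).symm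
    · refine (congrArg f (Sc.word_mul_word_of_not hu hv h)).trans ?_
      rw [f_word _ hu, f_word _ hv, f_zero]
      apply WithOne.coe_injective
      refine Eq.trans ?_ (congrArg₂ (· * ·) (hvalπ u hu.1) (hvalπ v hv.1)).symm
      have hnle : ¬ u + v ≤ w := fun hle =>
        h (Sc.isSubword_singleton.2 ⟨by simp [hu.1], hle⟩)
      -- Disjoint divisors of `w` have sum equal to their union, again a divisor of `w`; so a
      -- vanishing product comes from a shared letter.
      have hnd : ¬ Disjoint u v := fun hd => hnle <| by
        rw [Multiset.add_eq_union_iff_disjoint.2 hd]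
        exact Multiset.union_le (Sc.isSubword_singleton.1 hu).2 (Sc.isSubword_singleton.1 hv).2
      rw [Multiset.disjoint_left] at hnd
      push Not at hnd
      obtain ⟨x, hxu, hxv⟩ := hnd
      exact (hrep hxu hxv).symm

/-! ### Membership in varieties -/

/-- An ai-semiring with an absorbing element `c` is a subdirect product of the images of
homomorphisms which separate each `p ≠ c` from the elements not below `p`. -/
theorem mem_of_separating {V : Set AISrg.{u}} (hV : AISrg.IsVariety V) {A : AISrg.{u}} {c : A}
    (h0 : IsAbsorbing c)
    (h : ∀ p : A, p ≠ c → ∃ (Q : AISrg.{u}) (f : A → Q), Q ∈ V ∧ AISrg.IsHom f ∧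
      ∀ q, f q = f p → IsBelow q p) : A ∈ V := by
  choose Q f hQ hf hsep using fun p : {p : A // p ≠ c} => h p p.2
  refine hV.subalgebra (AISrg.prod Q) A (fun x p => f p x)
    ⟨fun x y => funext fun p => (hf p).1 x y, fun x y => funext fun p => (hf p).2 x y⟩ ?_
    (hV.product _ Q hQ)
  intro x y e
  have hle {x y : A} (e : (fun p => f p x) = fun p => f p y) (hy : y ≠ c) : IsBelow x y :=
    hsep ⟨y, hy⟩ x (congrFun e ⟨y, hy⟩)
  by_cases hx : x = c
  · by_contra hne
    have hy : y ≠ c := fun hy => hne (hx.trans hy.symm)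
    exact h0.not_isBelow hy (hx ▸ hle e hy)
  · by_cases hy : y = c
    · exact absurd (hy ▸ hle e.symm hx) (h0.not_isBelow hx)
    · exact (hle e hy).antisymm (hle e.symm hx)

/-- The subalgebra of `A` on a nonempty subset closed under the operations. -/
def AISrg.restrict (A : AISrg.{u}) (P : A → Prop) (hadd : ∀ x y, P x → P y → P (x + y))
    (hmul : ∀ x y, P x → P y → P (x * y)) (hne : ∃ x, P x) : AISrg.{u} :=
  letI : Add {x // P x} := ⟨fun x y => ⟨x.1 + y.1, hadd _ _ x.2 y.2⟩⟩
  letI : Mul {x // P x} := ⟨fun x y => ⟨x.1 * y.1, hmul _ _ x.2 y.2⟩⟩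
  @AISrg.mk {x // P x}
    { add_assoc := fun _ _ _ => Subtype.ext (add_assoc _ _ _)
      add_comm := fun _ _ => Subtype.ext (add_comm _ _)
      mul_assoc := fun _ _ _ => Subtype.ext (mul_assoc _ _ _)
      left_distrib := fun _ _ _ => Subtype.ext (left_distrib _ _ _)
      right_distrib := fun _ _ _ => Subtype.ext (right_distrib _ _ _)
      add_idem := fun _ => Subtype.ext (AISemiring.add_idem _) }
    (let ⟨x, hx⟩ := hne; ⟨⟨x, hx⟩⟩)

/-- A homomorphic image of a subalgebra, given by a relation compatible with the operations. -/
theorem AISrg.IsVariety.mem_of_rel {V : Set AISrg.{u}} (hV : IsVariety V) {A Q : AISrg.{u}}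
    (hA : A ∈ V) (R : A → Q → Prop) (hadd : ∀ s t x y, R s x → R t y → R (s + t) (x + y))
    (hmul : ∀ s t x y, R s x → R t y → R (s * t) (x * y))
    (huniq : ∀ s x y, R s x → R s y → x = y) (hsurj : ∀ x, ∃ s, R s x) : Q ∈ V := by
  let B : AISrg.{u} := A.restrict (fun s => ∃ x, R s x)
    (fun s t ⟨x, hx⟩ ⟨y, hy⟩ => ⟨x + y, hadd s t x y hx hy⟩)
    (fun s t ⟨x, hx⟩ ⟨y, hy⟩ => ⟨x * y, hmul s t x y hx hy⟩)
    (let ⟨x⟩ := (inferInstance : Nonempty Q); let ⟨s, hs⟩ := hsurj x; ⟨s, x, hs⟩)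
  have hB : B ∈ V := hV.subalgebra A B Subtype.val ⟨fun _ _ => rfl, fun _ _ => rfl⟩
    Subtype.val_injective hA
  choose f hf using fun s : {s : A // ∃ x, R s x} => s.2
  refine hV.homImage B Q f ⟨fun s t => ?_, fun s t => ?_⟩ (fun x => ?_) hB
  · exact huniq _ _ _ (hf _) (hadd _ _ _ _ (hf s) (hf t))
  · exact huniq _ _ _ (hf _) (hmul _ _ _ _ (hf s) (hf t))
  · obtain ⟨s, hs⟩ := hsurj x
    exact ⟨⟨s, x, hs⟩, huniq _ _ _ (hf ⟨s, x, hs⟩) hs⟩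

/-- A flat semiring `Q` lies in every variety containing a flat semiring `S` as soon as it has
enough maps to `S` that preserve its nonzero products. -/
theorem mem_of_partialHoms {V : Set AISrg.{u}} (hV : AISrg.IsVariety V) {S Q : AISrg.{u}}
    (hS : S ∈ V) {z : S} (hz : IsFlatZero z) {o : Q} (ho : IsFlatZero o) {I : Type u} [Nonempty I]
    (g : I → Q → S) (hne : ∀ i x, x ≠ o → g i x ≠ z)
    (hmul : ∀ i x y, x * y ≠ o → g i (x * y) = g i x * g i y)
    (hsep : ∀ x y, x ≠ o → y ≠ o → x ≠ y → ∃ i, g i x ≠ g i y)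
    (hzero : ∀ x y, x ≠ o → y ≠ o → x * y = o → ∃ i, g i x * g i y = z) : Q ∈ V := by
  -- Tuples with a coordinate `z` represent `o`; a nonzero `x` is represented only by the tuple of
  -- its images. `hsep` and `hzero` supply a coordinate `z` whenever a sum or product in `Q`
  -- vanishes.
  let R : AISrg.prod (fun _ : I => S) → Q → Prop := fun t x =>
    (∃ i, t i = z) ∧ x = o ∨ x ≠ o ∧ t = fun i => g i x
  refine hV.mem_of_rel (hV.product I (fun _ => S) fun _ => hS) R ?_ ?_ ?_ ?_
  · rintro s t x y (⟨⟨i, hi⟩, rfl⟩ | ⟨hx, rfl⟩) (⟨⟨j, hj⟩, rfl⟩ | ⟨hy, rfl⟩)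
    · exact Or.inl ⟨⟨i, (congrArg (· + t i) hi).trans (hz.zero_add _)⟩, ho.zero_add _⟩
    · exact Or.inl ⟨⟨i, (congrArg (· + g i y) hi).trans (hz.zero_add _)⟩, ho.zero_add _⟩
    · exact Or.inl ⟨⟨j, (congrArg (g j x + ·) hj).trans (hz.add_zero _)⟩, ho.add_zero _⟩
    · by_cases e : x = y
      · subst e
        rw [AISemiring.add_idem]
        exact Or.inr ⟨hx, funext fun i => AISemiring.add_idem (g i x)⟩
      · obtain ⟨i, hi⟩ := hsep x y hx hy e
        exact Or.inl ⟨⟨i, hz.add_of_ne _ _ hi⟩, ho.add_of_ne _ _ e⟩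
  · rintro s t x y (⟨⟨i, hi⟩, rfl⟩ | ⟨hx, rfl⟩) (⟨⟨j, hj⟩, rfl⟩ | ⟨hy, rfl⟩)
    · exact Or.inl ⟨⟨i, (congrArg (· * t i) hi).trans (hz.zero_mul _)⟩, ho.zero_mul _⟩
    · exact Or.inl ⟨⟨i, (congrArg (· * g i y) hi).trans (hz.zero_mul _)⟩, ho.zero_mul _⟩
    · exact Or.inl ⟨⟨j, (congrArg (g j x * ·) hj).trans (hz.mul_zero _)⟩, ho.mul_zero _⟩
    · by_cases e : x * y = o
      · obtain ⟨i, hi⟩ := hzero x y hx hy e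
        exact Or.inl ⟨⟨i, hi⟩, e⟩
      · exact Or.inr ⟨e, funext fun i => (hmul i x y e).symm⟩
  · rintro s x y (⟨⟨i, hi⟩, rfl⟩ | ⟨hx, rfl⟩) (⟨⟨j, hj⟩, rfl⟩ | ⟨hy, e⟩)
    · rfl
    · subst e; exact absurd hi (hne i y hy)
    · exact absurd hj (hne j x hx)
    · by_contra h
      obtain ⟨i, hi⟩ := hsep x y hx hy h
      exact hi (congrFun e i)
  · intro x
    by_cases hx : x = o
    · exact ⟨fun _ => z, Or.inl ⟨⟨Classical.arbitrary I, rfl⟩, hx⟩⟩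
    · exact ⟨fun i => g i x, Or.inr ⟨hx, rfl⟩⟩

/-! ### Flat semirings with `x² = xyz = 0` -/

/-- A set containing exactly one factor of each factorization of `p` into two factors. -/
def IsTransversal {Q : Type u} [Mul Q] (p : Q) (T : Set Q) : Prop :=
  (∀ x y, x * y = p → x ∈ T → y ∉ T) ∧ ∀ x y, x * y = p → x ∈ T ∨ y ∈ T

/-- Cofactors with respect to `p` are unique by 0-cancellation and differ from the element itself,
as squares vanish. So one may choose freely from each pair, and `x`, `y` (possibly equal) can be
chosen together because they are not cofactors. -/
theorem exists_isTransversal {Q : Type u} [AISemiring Q] {o p : Q} (ho : IsFlatZero o)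
    (hp : p ≠ o) (hc : ∀ x y : Q, x * y = y * x) (hsq : ∀ x : Q, x * x = o) {x y : Q}
    (hxy : x * y ≠ p) : ∃ T, IsTransversal p T ∧ x ∈ T ∧ y ∈ T := by
  have hsq' (z : Q) : z * z ≠ p := fun e => hp (e.symm.trans (hsq z))
  -- Outside the pairs of `x` and `y`, the smaller cofactor in a well-order is taken; elements
  -- without a cofactor belong vacuously.
  refine ⟨{z | z = x ∨ z = y ∨ ∀ w, z * w = p → w ≠ x ∧ w ≠ y ∧ WellOrderingRel z w},
    ⟨?_, ?_⟩, Or.inl rfl, Or.inr (Or.inl rfl)⟩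
  · rintro z w hzw hz hw
    have hwz : w * z = p := hc w z ▸ hzw
    rcases hz with rfl | rfl | hz
    · rcases hw with rfl | rfl | hw
      · exact hsq' _ hzw
      · exact hxy hzw
      · exact (hw _ hwz).1 rfl
    · rcases hw with rfl | rfl | hw
      · exact hxy hwz
      · exact hsq' _ hzw
      · exact (hw _ hwz).2.1 rfl
    · rcases hw with rfl | rfl | hw
      · exact (hz _ hzw).1 rfl
      · exact (hz _ hzw).2.1 rfl
      · exact asymm (hz _ hzw).2.2 (hw _ hwz).2.2
  · intro z w hzw
    have hwz : w * z = p := hc w z ▸ hzw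
    by_cases hz : z = x ∨ z = y
    · exact Or.inl (hz.imp id Or.inl)
    by_cases hw : w = x ∨ w = y
    · exact Or.inr (hw.imp id Or.inl)
    push Not at hz hw
    have huniq {z w v : Q} (h1 : z * w = p) (h2 : z * v = p) : v = w :=
      ho.mul_left_cancel (h2.trans h1.symm) (h2 ▸ hp)
    rcases trichotomous_of (WellOrderingRel (α := Q)) z w with h | h | h
    · refine Or.inl (Or.inr (Or.inr fun v hv => ?_))
      rw [huniq hzw hv]
      exact ⟨hw.1, hw.2, h⟩
    · exact absurd (h ▸ hzw) (hsq' w)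
    · refine Or.inr (Or.inr (Or.inr fun v hv => ?_))
      rw [huniq hwz hv]
      exact ⟨hz.1, hz.2, h⟩

open Classical in
/-- Let `Q` and `S` be commutative flat semirings with `x² ≈ 0` and `xyz ≈ 0`, where
multiplication is not trivial on `S` and the nonzero elements of `Q` divide `p`. Then `Q` lies in
every variety containing `S`. -/
theorem flat_mem_of_nilpotent {V : Set AISrg.{u}} (hV : AISrg.IsVariety V) {S Q : AISrg.{u}}
    (hS : S ∈ V) {z : S} (hz : IsFlatZero z) (hSc : ∀ x y : S, x * y = y * x)
    (hSsq : ∀ x : S, x * x = z) (hS3 : ∀ x y t : S, x * y * t = z) {α β : S} (hαβ : α * β ≠ z)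
    {o p : Q} (ho : IsFlatZero o) (hc : ∀ x y : Q, x * y = y * x) (hsq : ∀ x : Q, x * x = o)
    (h3 : ∀ x y t : Q, x * y * t = o) (hp : p ≠ o) (hdiv : ∀ x, x ≠ o → x = p ∨ ∃ u, u * x = p) :
    Q ∈ V := by
  have hα : α ≠ z := fun e => hαβ (by rw [e, hz.zero_mul])
  have hβ : β ≠ z := fun e => hαβ (by rw [e, hz.mul_zero])
  have hαneβ : α ≠ β := fun e => hαβ (by rw [e, hSsq])
  have hαγ : α ≠ α * β := fun e => hαβ (by rw [e, hS3])
  -- If a nonzero product divided `p` properly, `p` would be a product of three factors, hence `o`.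
  have hmulp {x y : Q} (h : x * y ≠ o) : x * y = p := by
    refine (hdiv _ h).resolve_right ?_
    rintro ⟨u, hu⟩
    exact hp (by rw [← hu, ← mul_assoc, h3])
  have hpmul {x y : Q} (h : x * y = p) : x ≠ p ∧ y ≠ p := by
    constructor
    · rintro rfl
      exact hp (by rw [← h, ← h, h3])
    · rintro rfl
      exact hp (by rw [← h, ← h, ← mul_assoc, h3])
  have hT {x y : Q} (h : x * y ≠ p) := exists_isTransversal ho hp hc hsq h
  have hsq' (x : Q) : x * x ≠ p := fun e => hp (e.symm.trans (hsq x))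
  -- The value at `o` is irrelevant: only nonzero elements are represented by their images.
  let g : {T : Set Q // IsTransversal p T} → Q → S := fun T x =>
    if x = p then α * β else if x ∈ T.1 then α else β
  have gp (T) : g T p = α * β := if_pos rfl
  have gα (T) {x : Q} (hx : x ≠ p) (h : x ∈ T.1) : g T x = α := (if_neg hx).trans (if_pos h)
  have gβ (T) {x : Q} (hx : x ≠ p) (h : x ∉ T.1) : g T x = β := (if_neg hx).trans (if_neg h)
  have : Nonempty {T : Set Q // IsTransversal p T} :=
    let ⟨T, h, _⟩ := hT (hsq' p); ⟨⟨T, h⟩⟩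
  refine mem_of_partialHoms hV hS hz ho g ?_ ?_ ?_ ?_
  · intro T x _
    by_cases hx : x = p
    · rw [hx, gp]; exact hαβ
    · by_cases h : x ∈ T.1
      · rw [gα T hx h]; exact hα
      · rw [gβ T hx h]; exact hβ
  · intro T x y hxy
    have e := hmulp hxy
    obtain ⟨hx, hy⟩ := hpmul e
    rw [e, gp]
    by_cases h : x ∈ T.1
    · rw [gα T hx h, gβ T hy (T.2.1 x y e h)]
    · rw [gβ T hx h, gα T hy ((T.2.2 x y e).resolve_left h), hSc]
  · intro x y hx hy hxy
    by_cases hxp : x = p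
    · obtain ⟨T, h, hyT, -⟩ := hT (hsq' y)
      refine ⟨⟨T, h⟩, ?_⟩
      rw [hxp, gp, gα _ (fun e => hxy (hxp.trans e.symm)) hyT]
      exact hαγ.symm
    by_cases hyp : y = p
    · obtain ⟨T, h, hxT, -⟩ := hT (hsq' x)
      refine ⟨⟨T, h⟩, ?_⟩
      rw [hyp, gp, gα _ hxp hxT]
      exact hαγ
    -- With `u` the cofactor of `y`, a transversal through `u` and `x` omits `y`, so it separates
    -- `x` from `y`.
    obtain ⟨u, hu⟩ := (hdiv y hy).resolve_left hyp
    have hux : u * x ≠ p := fun e =>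
      hxy (ho.mul_left_cancel (e.trans hu.symm) (e ▸ hp))
    obtain ⟨T, h, huT, hxT⟩ := hT hux
    refine ⟨⟨T, h⟩, ?_⟩
    rw [gα _ hxp hxT, gβ _ hyp (h.1 u y hu huT)]
    exact hαneβ
  · intro x y hx hy hxy
    by_cases hxp : x = p
    · exact ⟨Classical.arbitrary _, by rw [hxp, gp, hS3]⟩
    by_cases hyp : y = p
    · exact ⟨Classical.arbitrary _, by rw [hyp, gp, ← mul_assoc, hS3]⟩
    -- Choosing both factors sends each of them to `α`, and `α * α = z`.
    obtain ⟨T, h, hxT, hyT⟩ := hT (x := x) (y := y) (hxy ▸ hp.symm)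
    exact ⟨⟨T, h⟩, by rw [gα _ hxp hxT, gα _ hyp hyT, hSsq]⟩

/-! ### The varieties generated by `S_c(a)`, `S_c(ab)` and `S_c(abc)` -/

section Main

variable {X : Type u}

theorem nodup_pair {a b : X} (hab : a ≠ b) : ({a, b} : Multiset X).Nodup := by
  simp [hab]

theorem nodup_triple {a b c : X} (hab : a ≠ b) (hac : a ≠ c) (hbc : b ≠ c) :
    ({a, b, c} : Multiset X).Nodup := by
  simp [hab, hac, hbc]

theorem Sc.exists_ne (a : X) : ∃ x y : ScWord {a}, x ≠ y :=
  ⟨Sc.zero, Sc.word {a} (Sc.isSubword_singleton.2 ⟨by simp, le_rfl⟩), nofun⟩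

theorem Sc.exists_mul_ne {a b : X} :
    ∃ x y : Sc ({{a, b}} : Set (Multiset X)), x * y ≠ Sc.zero := by
  have ha : IsSubword {({a, b} : Multiset X)} {a} := isSubword_singleton.2 ⟨by simp, by simp⟩
  have hb : IsSubword {({a, b} : Multiset X)} {b} := isSubword_singleton.2 ⟨by simp, by simp⟩
  have h : IsSubword {({a, b} : Multiset X)} ({a} + {b}) := isSubword_singleton.2 ⟨by simp, le_rfl⟩
  refine ⟨word _ ha, word _ hb, ?_⟩
  rw [word_mul_word ha hb h]
  exact nofun

theorem Sc.exists_mul_mul_ne {a b c : X} :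
    ∃ x y z : Sc ({{a, b, c}} : Set (Multiset X)), x * y * z ≠ Sc.zero := by
  have ha : IsSubword {({a, b, c} : Multiset X)} {a} := isSubword_singleton.2 ⟨by simp, by simp⟩
  have hb : IsSubword {({a, b, c} : Multiset X)} {b} := isSubword_singleton.2 ⟨by simp, by simp⟩
  have hc : IsSubword {({a, b, c} : Multiset X)} {c} := isSubword_singleton.2 ⟨by simp, by simp⟩
  have h : IsSubword {({a, b, c} : Multiset X)} ({a} + {b} + {c}) :=
    isSubword_singleton.2 ⟨by simp, le_of_eq (add_assoc _ _ _)⟩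
  have h' := isSubword_left (by simp) h
  refine ⟨word _ ha, word _ hb, word _ hc, ?_⟩
  rw [word_mul_word ha hb h', word_mul_word h' hc h]
  exact nofun

theorem contextIdentities_of_mem_varietySc {w : Multiset X} {A : AISrg.{u}}
    (hA : A ∈ varietySc w) : ContextIdentities A :=
  AISrg.contextIdentities_of_mem_flatVariety (varietySc_subset_flatVariety w hA)

/-- The common value of all squares: `x²y ≈ x²` makes it a multiplicative zero, and the context
identities make it absorb sums. -/
theorem exists_isAbsorbing_of_mem_varietySc {w : Multiset X} (hw : w.Nodup) {A : AISrg.{u}}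
    (hA : A ∈ varietySc w) : ∃ c : A, IsAbsorbing c ∧ ∀ x : A, x * x = c := by
  obtain ⟨t⟩ := (inferInstance : Nonempty A)
  have h := mul_self_mul_of_mem_varietySc hw hA t
  exact ⟨t * t, (contextIdentities_of_mem_varietySc hA).isAbsorbing h
    fun x => (mul_comm_of_mem_varietySc hA _ _).trans (h x),
    fun x => mul_self_eq_of_mem_varietySc hw hA x t⟩

/-- Every element of `A` other than the absorbing one has nonzero image in some flat semiring of
the variety. -/
theorem exists_flat_of_mem_varietySc {w : Multiset X} {A : AISrg.{u}}
    (hA : A ∈ varietySc w) {c : A} (hc : IsAbsorbing c) (hsq : ∀ x : A, x * x = c)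
    {V : Set AISrg.{u}} (hV : AISrg.IsVariety V) (hAV : A ∈ V) {p : A} (hp : p ≠ c) :
    ∃ (Q : AISrg.{u}) (f : A → Q) (o : Q), Q ∈ V ∧ AISrg.IsHom f ∧ IsFlatZero o ∧ f p ≠ o ∧
      (∀ x y : Q, x * y = y * x) ∧ ∀ x : Q, x * x = o := by
  have hcomm := mul_comm_of_mem_varietySc hA
  obtain ⟨Q, f, hf, hs, ho, hsep, -⟩ :=
    exists_flat_quotient (contextIdentities_of_mem_varietySc hA) hcomm hc hp
  refine ⟨Q, f, f c, hV.homImage A Q f hf hs hAV, hf, ho,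
    fun e => hc.not_isBelow hp (hsep c e.symm), fun x y => ?_, fun x => ?_⟩
  · obtain ⟨x, rfl⟩ := hs x
    obtain ⟨y, rfl⟩ := hs y
    rw [← hf.2, hcomm, hf.2]
  · obtain ⟨x, rfl⟩ := hs x
    rw [← hf.2, hsq]

/-- Here and in the next two lemmas, failure of a constancy law gives a product different from the
absorbing element. Its image in a flat quotient lying in `V` is nonzero, and its factors serve as
values of the letters. -/
theorem scWord_singleton_mem {w : Multiset X} (hw : w.Nodup) {A : AISrg.{u}}
    (hA : A ∈ varietySc w) {V : Set AISrg.{u}} (hV : AISrg.IsVariety V) (hAV : A ∈ V)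
    (h : ∃ x y : A, x ≠ y) (a : X) : ScWord {a} ∈ V := by
  obtain ⟨c, hc, hsq⟩ := exists_isAbsorbing_of_mem_varietySc hw hA
  obtain ⟨p, hp⟩ : ∃ p : A, p ≠ c := by
    by_contra! h'
    obtain ⟨x, y, hxy⟩ := h
    exact hxy ((h' x).trans (h' y).symm)
  obtain ⟨Q, f, o, hQ, hf, ho, hfp, hQc, hQsq⟩ := exists_flat_of_mem_varietySc hA hc hsq hV hAV hp
  refine scWord_mem_of_prod_ne (by simp) hV hQ hQc ho hQsq (fun _ => f p) ?_
  simpa using hfp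

open Classical in
theorem scWord_pair_mem {w : Multiset X} (hw : w.Nodup) {A : AISrg.{u}}
    (hA : A ∈ varietySc w) {V : Set AISrg.{u}} (hV : AISrg.IsVariety V) (hAV : A ∈ V)
    (h : ¬ ∀ x₁ x₂ y₁ y₂ : A, x₁ * x₂ = y₁ * y₂) {a b : X} (hab : a ≠ b) :
    ScWord {a, b} ∈ V := by
  obtain ⟨c, hc, hsq⟩ := exists_isAbsorbing_of_mem_varietySc hw hA
  obtain ⟨x, y, hp⟩ : ∃ x y : A, x * y ≠ c := by
    by_contra! h'
    exact h fun x₁ x₂ y₁ y₂ => (h' x₁ x₂).trans (h' y₁ y₂).symm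
  obtain ⟨Q, f, o, hQ, hf, ho, hfp, hQc, hQsq⟩ := exists_flat_of_mem_varietySc hA hc hsq hV hAV hp
  refine scWord_mem_of_prod_ne (nodup_pair hab) hV hQ hQc ho hQsq
    (fun t => if t = a then f x else f y) ?_
  simp only [Multiset.insert_eq_cons, Multiset.map_cons, Multiset.map_singleton,
    Multiset.prod_cons, Multiset.prod_singleton, if_pos, if_neg hab.symm]
  rw [hf.2] at hfp
  exact fun e => hfp (WithOne.coe_injective ((WithOne.coe_mul _ _).trans e))

open Classical in
theorem scWord_triple_mem {w : Multiset X} (hw : w.Nodup) {A : AISrg.{u}}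
    (hA : A ∈ varietySc w) {V : Set AISrg.{u}} (hV : AISrg.IsVariety V) (hAV : A ∈ V)
    (h : ¬ ∀ x₁ x₂ x₃ y₁ y₂ y₃ : A, x₁ * x₂ * x₃ = y₁ * y₂ * y₃) {a b c : X} (hab : a ≠ b)
    (hac : a ≠ c) (hbc : b ≠ c) : ScWord {a, b, c} ∈ V := by
  obtain ⟨d, hd, hsq⟩ := exists_isAbsorbing_of_mem_varietySc hw hA
  obtain ⟨x, y, z, hp⟩ : ∃ x y z : A, x * y * z ≠ d := by
    by_contra! h'
    exact h fun x₁ x₂ x₃ y₁ y₂ y₃ => (h' x₁ x₂ x₃).trans (h' y₁ y₂ y₃).symm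
  obtain ⟨Q, f, o, hQ, hf, ho, hfp, hQc, hQsq⟩ := exists_flat_of_mem_varietySc hA hd hsq hV hAV hp
  refine scWord_mem_of_prod_ne (nodup_triple hab hac hbc) hV hQ hQc ho hQsq
    (fun t => if t = a then f x else if t = b then f y else f z) ?_
  simp only [Multiset.insert_eq_cons, Multiset.map_cons, Multiset.map_singleton,
    Multiset.prod_cons, Multiset.prod_singleton, if_pos, if_neg hab.symm, if_neg hac.symm,
    if_neg hbc.symm]
  rw [mul_assoc, hf.2, hf.2] at hfp
  refine fun e => hfp (WithOne.coe_injective (Eq.trans ?_ e))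
  rw [WithOne.coe_mul, WithOne.coe_mul]

open Classical in
/-- `V(S_c(a))` contains all ai-semirings with constant multiplication whose product is the
greatest element. -/
theorem mem_varietySc_singleton {A : AISrg.{u}} {c : A} (hc : IsAbsorbing c)
    (hmul : ∀ x y : A, x * y = c) (a : X) : A ∈ varietySc {a} := by
  refine mem_of_separating (isVariety_varietySc _) hc fun p hp => ?_
  have ha : IsSubword {({a} : Multiset X)} {a} := Sc.isSubword_singleton.2 ⟨by simp, le_rfl⟩
  have hne : Sc.word _ ha ≠ Sc.zero := nofun
  -- The indicator of the elements below `p` respects sums since `x + y ≤ p` iff both summands are;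
  -- all products equal `c`, which is not below `p`.
  let f : A → Sc {({a} : Multiset X)} := fun x => if IsBelow x p then Sc.word _ ha else Sc.zero
  have f_pos {x : A} (h : IsBelow x p) : f x = Sc.word _ ha := if_pos h
  have f_neg {x : A} (h : ¬ IsBelow x p) : f x = Sc.zero := if_neg h
  refine ⟨ScWord {a}, f, scWord_mem_varietySc _, ⟨fun x y => ?_, fun x y => ?_⟩, fun q hq => ?_⟩
  · show f (x + y) = f x + f y
    by_cases hx : IsBelow x p
    · by_cases hy : IsBelow y p
      · rw [f_pos hx, f_pos hy, f_pos (isBelow_add_iff.2 ⟨hx, hy⟩), Sc.add_self]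
      · rw [f_neg hy, f_neg fun h => hy (isBelow_add_iff.1 h).2, Sc.isFlatZero.add_zero]
    · rw [f_neg hx, f_neg fun h => hx (isBelow_add_iff.1 h).1, Sc.zero_add']
  · show f (x * y) = f x * f y
    rw [hmul, f_neg (hc.not_isBelow hp), Sc.mul_eq_zero_of_card (by simp)]
  · by_contra h
    exact hne ((f_pos (IsBelow.refl p)).symm.trans (hq.symm.trans (f_neg h)))

theorem mem_varietySc_pair {a b : X} (hab : a ≠ b) {A : AISrg.{u}} (hA : A ∈ AISrg.flatVariety)
    (hcomm : ∀ x y : A, x * y = y * x) (hsq : ∀ x y : A, x * x * y = x * x)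
    (h3 : ∀ x₁ x₂ x₃ y₁ y₂ y₃ : A, x₁ * x₂ * x₃ = y₁ * y₂ * y₃) : A ∈ varietySc {a, b} := by
  obtain ⟨t⟩ := (inferInstance : Nonempty A)
  have hctx := AISrg.contextIdentities_of_mem_flatVariety hA
  have h0 : IsAbsorbing (t * t) := hctx.isAbsorbing (hsq t) fun x => (hcomm _ _).trans (hsq t x)
  -- Each square is a threefold product, `x² = x²x`, so all squares agree.
  have hsq' (x : A) : x * x = t * t := by
    rw [← hsq x x, ← hsq t t]
    exact h3 _ _ _ _ _ _
  have h3' (x y z : A) : x * y * z = t * t := by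
    rw [← hsq t t]
    exact h3 _ _ _ _ _ _
  refine mem_of_separating (isVariety_varietySc _) h0 fun p hp => ?_
  obtain ⟨Q, f, hf, hs, ho, hsep, hdiv⟩ := exists_flat_quotient hctx hcomm h0 hp
  refine ⟨Q, f, ?_, hf, hsep⟩
  obtain ⟨α, β, hαβ⟩ := Sc.exists_mul_ne (a := a) (b := b)
  refine flat_mem_of_nilpotent (S := ScWord {a, b}) (z := Sc.zero) (α := α) (β := β) (p := f p)
    (isVariety_varietySc _) (scWord_mem_varietySc _) Sc.isFlatZero Sc.mul_comm'
    (Sc.mul_self_eq_zero (nodup_pair hab)) (Sc.mul_mul_eq_zero_of_card (by simp)) hαβ ho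
    (fun x y => ?_) (fun x => ?_) (fun x y z => ?_)
    (fun e => h0.not_isBelow hp (hsep _ e.symm)) fun x hx => ?_
  · obtain ⟨x, rfl⟩ := hs x
    obtain ⟨y, rfl⟩ := hs y
    rw [← hf.2, hcomm, hf.2]
  · obtain ⟨x, rfl⟩ := hs x
    rw [← hf.2, hsq']
  · obtain ⟨x, rfl⟩ := hs x
    obtain ⟨y, rfl⟩ := hs y
    obtain ⟨z, rfl⟩ := hs z
    rw [← hf.2, ← hf.2, h3']
  · obtain ⟨x, rfl⟩ := hs x
    exact (hdiv x hx).imp id fun ⟨u, hu⟩ => ⟨f u, by rw [← hf.2, hu]⟩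

theorem mem_varietySc_pair_iff {a b : X} (hab : a ≠ b) (A : AISrg.{u}) :
    A ∈ varietySc {a, b} ↔ A ∈ AISrg.flatVariety ∧ (∀ x y : A, x * y = y * x) ∧
      (∀ x y : A, x * x * y = x * x) ∧
      (∀ x₁ x₂ x₃ y₁ y₂ y₃ : A, x₁ * x₂ * x₃ = y₁ * y₂ * y₃) :=
  ⟨fun h => ⟨varietySc_subset_flatVariety _ h, mul_comm_of_mem_varietySc h,
    mul_self_mul_of_mem_varietySc (nodup_pair hab) h, mul_mul_eq_of_mem_varietySc (by simp) h⟩,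
    fun h => mem_varietySc_pair hab h.1 h.2.1 h.2.2.1 h.2.2.2⟩

theorem trivialVariety_ssubset_varietySc (a : X) : AISrg.trivialVariety ⊂ varietySc {a} := by
  refine ⟨AISrg.trivialVariety_subset (isVariety_varietySc _), fun h => ?_⟩
  obtain ⟨x, y, hxy⟩ := Sc.exists_ne a
  have : Subsingleton (ScWord {a}) := h (scWord_mem_varietySc {a})
  exact hxy (Subsingleton.elim x y)

/-- Strictness: constant multiplication would equate a nonzero product with a square, which is zero.
The next inclusion is strict likewise, with threefold products. -/
theorem varietySc_singleton_ssubset {a b : X} (hab : a ≠ b) :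
    varietySc {a} ⊂ varietySc {a, b} := by
  obtain ⟨x, y, hxy⟩ := Sc.exists_mul_ne (a := a) (b := b)
  refine ⟨varietySc_subset (isVariety_varietySc _) (scWord_singleton_mem (nodup_pair hab)
    (scWord_mem_varietySc _) (isVariety_varietySc _) (scWord_mem_varietySc _)
    ⟨x * y, Sc.zero, hxy⟩ a), fun h => hxy ?_⟩
  exact (mul_eq_of_mem_varietySc (by simp) (h (scWord_mem_varietySc {a, b})) x y x x).trans
    (Sc.mul_self_eq_zero (nodup_pair hab) x)

theorem varietySc_pair_ssubset {a b c : X} (hab : a ≠ b) (hac : a ≠ c) (hbc : b ≠ c) :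
    varietySc {a, b} ⊂ varietySc {a, b, c} := by
  obtain ⟨x, y, z, h⟩ := Sc.exists_mul_mul_ne (a := a) (b := b) (c := c)
  have hw := nodup_triple hab hac hbc
  refine ⟨varietySc_subset (isVariety_varietySc _) (scWord_pair_mem hw
    (scWord_mem_varietySc _) (isVariety_varietySc _) (scWord_mem_varietySc _)
    (fun e => h ((e (x * y) z x x).trans (Sc.mul_self_eq_zero hw x))) hab), fun hle => h ?_⟩
  refine (mul_mul_eq_of_mem_varietySc (by simp) (hle (scWord_mem_varietySc {a, b, c}))
    x y z x x x).trans ?_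
  exact (congrArg (· * x) (Sc.mul_self_eq_zero hw x)).trans (Sc.zero_mul' x)

/-- The subvarieties of `V(S_c(abc))`. -/
theorem subvariety_varietySc_triple {a b c : X} (hab : a ≠ b) (hac : a ≠ c) (hbc : b ≠ c)
    {V : Set AISrg.{u}} (hV : AISrg.IsVariety V) (hle : V ⊆ varietySc {a, b, c}) :
    V = varietySc {a, b, c} ∨ V = varietySc {a, b} ∨ V = varietySc {a} ∨
      V = AISrg.trivialVariety := by
  have hw := nodup_triple hab hac hbc
  by_cases h3 : ∀ A ∈ V, ∀ x₁ x₂ x₃ y₁ y₂ y₃ : A, x₁ * x₂ * x₃ = y₁ * y₂ * y₃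
  swap
  · push Not at h3
    obtain ⟨A, hA, x₁, x₂, x₃, y₁, y₂, y₃, h⟩ := h3
    exact Or.inl (hle.antisymm (varietySc_subset hV (scWord_triple_mem hw (hle hA) hV hA
      (fun e => h (e _ _ _ _ _ _)) hab hac hbc)))
  right
  by_cases h2 : ∀ A ∈ V, ∀ x₁ x₂ y₁ y₂ : A, x₁ * x₂ = y₁ * y₂
  swap
  · push Not at h2
    obtain ⟨A, hA, x₁, x₂, y₁, y₂, h⟩ := h2
    refine Or.inl (Set.Subset.antisymm (fun B hB => ?_) (varietySc_subset hV
      (scWord_pair_mem hw (hle hA) hV hA (fun e => h (e _ _ _ _)) hab)))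
    -- With threefold products constant, part (2) applies to every member of `V`.
    exact mem_varietySc_pair hab (varietySc_subset_flatVariety _ (hle hB))
      (mul_comm_of_mem_varietySc (hle hB)) (mul_self_mul_of_mem_varietySc hw (hle hB)) (h3 B hB)
  right
  by_cases h1 : ∀ A ∈ V, ∀ x y : A, x = y
  swap
  · push Not at h1
    obtain ⟨A, hA, h⟩ := h1
    refine Or.inl (Set.Subset.antisymm (fun B hB => ?_) (varietySc_subset hV
      (scWord_singleton_mem hw (hle hA) hV hA h a)))
    -- The constant value of the multiplication is that of the squares, the absorbing element.
    obtain ⟨d, hd, hsq⟩ := exists_isAbsorbing_of_mem_varietySc hw (hle hB)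
    exact mem_varietySc_singleton hd (fun x y => (h2 B hB x y d d).trans (hsq d)) a
  exact Or.inr (Set.Subset.antisymm (fun A hA => ⟨h1 A hA⟩) (AISrg.trivialVariety_subset hV))

end Main

theorem mainTheorem7 (X : Type u) (a b c : X) (hab : a ≠ b) (hac : a ≠ c) (hbc : b ≠ c) :
    -- the subvarieties of `V(S_c(abc))` are exactly the four listed ones
    (∀ V : Set AISrg.{u}, (AISrg.IsVariety V ∧ V ⊆ varietySc {a, b, c}) ↔
      V = varietySc {a, b, c} ∨ V = varietySc {a, b} ∨ V = varietySc {a} ∨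
        V = AISrg.trivialVariety) ∧
    -- which are pairwise distinct and form a chain
    (AISrg.trivialVariety ⊂ varietySc {a} ∧ varietySc {a} ⊂ varietySc {a, b} ∧
      varietySc {a, b} ⊂ varietySc {a, b, c}) ∧
    -- so that the lattice of subvarieties is a 4-element chain
    Nonempty (AISrg.Subvariety (varietySc {a, b, c}) ≃o Fin 4) ∧
    -- `V(S_c(ab))` is determined within `F` by `xy ≈ yx`, `x²y ≈ x²`, `x₁x₂x₃ ≈ y₁y₂y₃`
    (∀ A : AISrg.{u}, A ∈ varietySc {a, b} ↔
      A ∈ AISrg.flatVariety ∧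
      (∀ x y : A, x * y = y * x) ∧
      (∀ x y : A, x * x * y = x * x) ∧
      (∀ x₁ x₂ x₃ y₁ y₂ y₃ : A, x₁ * x₂ * x₃ = y₁ * y₂ * y₃)) := by
  have s1 := trivialVariety_ssubset_varietySc a
  have s2 := varietySc_singleton_ssubset hab
  have s3 := varietySc_pair_ssubset hab hac hbc
  have l2 := s3.subset
  have l1 := s2.subset.trans l2
  have l0 := s1.subset.trans l1
  refine ⟨fun V => ⟨fun h => subvariety_varietySc_triple hab hac hbc h.1 h.2, ?_⟩,
    ⟨s1, s2, s3⟩, ?_, mem_varietySc_pair_iff hab⟩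
  · rintro (rfl | rfl | rfl | rfl)
    · exact ⟨isVariety_varietySc _, subset_rfl⟩
    · exact ⟨isVariety_varietySc _, l2⟩
    · exact ⟨isVariety_varietySc _, l1⟩
    · exact ⟨AISrg.isVariety_trivialVariety, l0⟩
  · let F : Fin 4 → AISrg.Subvariety (varietySc {a, b, c}) :=
      ![⟨AISrg.trivialVariety, AISrg.isVariety_trivialVariety, l0⟩,
        ⟨varietySc {a}, isVariety_varietySc _, l1⟩,
        ⟨varietySc {a, b}, isVariety_varietySc _, l2⟩,
        ⟨varietySc {a, b, c}, isVariety_varietySc _, subset_rfl⟩]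
    have hF : StrictMono F := by
      rw [Fin.strictMono_iff_lt_succ]
      intro i
      fin_cases i
      · exact s1
      · exact s2
      · exact s3
    refine ⟨(StrictMono.orderIsoOfSurjective F hF ?_).symm⟩
    rintro ⟨V, hV, hle⟩
    rcases subvariety_varietySc_triple hab hac hbc hV hle with rfl | rfl | rfl | rfl
    · exact ⟨3, rfl⟩
    · exact ⟨2, rfl⟩
    · exact ⟨1, rfl⟩
    · exact ⟨0, rfl⟩
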